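/- **Theorem (Representation Theorem).** A *Chu space* over $[0,1]$ is a triple $(X,A,e)$ of a set $X$ of points, a set $A$ of attributes and a map $e:X\times A\to[0,1]$. A *Chu morphism* $(X,A,e)\to(X',A',e')$ is a pair of maps $f_*:X\to X'$, $f^*:A'\to A$ with $e(x,f^*(a'))=e'(f_*(x),a')$ for all $x\in X$, $a'\in A'$; composition is componentwise. $(X,A,e)$ is *biextensional* if $e(x,a_1)=e(x,a_2)$ for all $x\in X$ implies $a_1=a_2$, and $e(x_1,a)=e(x_2,a)$ for all $a\in A$ implies $x_1=x_2$. Let $\mathbf{bmChu}$ be the category of biextensional Chu spaces over $[0,1]$ and Chu morphisms $f$ with $f_*$ injective. A map $U:\mathcal H\to\mathcal K$ of complex Hilbert spaces is *semiunitary* if it is bijective and, for $\sigma$ either the identity of $\mathbb C$ ($U$ unitary) or complex conjugation ($U$ antiunitary), $U(\phi+\psi)=U\phi+U\psi$, $U(\lambda\phi)=\sigma(\lambda)U\phi$ and $\langle U\phi,U\psi\rangle=\sigma(\langle\phi,\psi\rangle)$ for all $\phi,\psi\in\mathcal H$, $\lambda\in\mathbb C$. The *projective quantum symmetry groupoid*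 $\mathbb P\mathbf{SymmH}$ has as objects the complex Hilbert spaces of dimension greater than $2$, and as morphisms $\mathcal H\to\mathcal K$ the equivalence classes $[U]$ of semiunitary maps $U:\mathcal H\to\mathcal K$, where $U\sim V$ if and only if $U=\lambda V$ for some $\lambda\in\mathbb C$ with $|\lambda|=1$; composition is induced by composition of maps. For a Hilbert space $\mathcal H$ let $\mathsf P(\mathcal H)$ be the set of its rays $[\psi]$, $\psi\in\mathcal H\setminus\{0\}$ (one-dimensional subspaces), $\mathsf L(\mathcal H)$ the set of its closed subspaces, $P_S$ the orthogonal projection onto $S\in\mathsf L(\mathcal H)$, and $$\bar e_{\mathcal H}([\psi],S)=\frac{\|P_S\psi\|^2}{\|\psi\|^2}\in[0,1].$$ Then $$\mathcal H\mapsto(\mathsf P(\mathcal H),\mathsf L(\mathcal H),\bar e_{\mathcal H}),\qquad [U]\mapsto(\mathsf P(U),U^{-1}),$$ where $\mathsf P(U)([\psi])=[U\psi]$ and $U^{-1}(S)=\{\psi\in\mathcal H: U\psi\in S\}$, is a well-defined functor $\mathsf PR:\mathbb P\mathbf{SymmH}\to\mathbf{bmChu}$, and it is full and faithful. -/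

import Mathlib

universe u

noncomputable section

namespace QuantumChu

open CategoryTheory

/-! ### Chu spaces -/

/-- A Chu space `(X, A, e)` over `K`: a set of points, a set of attributes, and an evaluation. -/
structure Chu (K : Type) where
  /-- The points. -/
  Pt : Type u
  /-- The attributes. -/
  At : Type u
  /-- The evaluation function. -/
  eval : Pt → At → K

namespace Chu

/-- A Chu morphism `(f_*, f^*)`. -/
@[ext]
structure Hom {K : Type} (C D : Chu.{u} K) where
  /-- The forward map `f_*` on points. -/
  pt : C.Pt → D.Pt
  /-- The backward map `f^*` on attributes. -/
  at' : D.At → C.At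
  /-- The adjointness condition `e(x, f^*(a')) = e'(f_*(x), a')`. -/
  eval_eq : ∀ (x : C.Pt) (a : D.At), C.eval x (at' a) = D.eval (pt x) a

instance (K : Type) : Category (Chu.{u} K) where
  Hom C D := Hom C D
  id C := ⟨id, id, fun _ _ => rfl⟩
  comp f g := ⟨g.pt ∘ f.pt, f.at' ∘ g.at', fun x a =>
    (f.eval_eq x (g.at' a)).trans (g.eval_eq (f.pt x) a)⟩

/-- Two attributes with the same evaluation at all points are equal. -/
def IsExtensional {K : Type} (C : Chu.{u} K) : Prop :=
  ∀ a₁ a₂ : C.At, (∀ x, C.eval x a₁ = C.eval x a₂) → a₁ = a₂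

/-- Two points with the same evaluation at all attributes are equal. -/
def IsSeparated {K : Type} (C : Chu.{u} K) : Prop :=
  ∀ x₁ x₂ : C.Pt, (∀ a, C.eval x₁ a = C.eval x₂ a) → x₁ = x₂

/-- Biextensional Chu spaces. -/
def IsBiextensional (K : Type) : ObjectProperty (Chu.{u} K) :=
  fun C => C.IsExtensional ∧ C.IsSeparated

end Chu

/-- The full subcategory `bChu_K` of biextensional Chu spaces. -/
abbrev BChu (K : Type) := (Chu.IsBiextensional.{u} K).FullSubcategory

/-- The Chu morphisms whose map on points is injective. -/
def injectiveOnPoints (K : Type) : MorphismProperty (BChu.{u} K) :=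
  fun _ _ f => Function.Injective f.hom.pt

instance (K : Type) : (injectiveOnPoints.{u} K).IsMultiplicative where
  id_mem _ := Function.injective_id
  comp_mem f g (hf : Function.Injective f.hom.pt) (hg : Function.Injective g.hom.pt) :=
    show Function.Injective (g.hom.pt ∘ f.hom.pt) from hg.comp hf

/-- The subcategory `bmChu` of `bChu_[0,1]`: all biextensional Chu spaces over the unit interval,
with the Chu morphisms `f` for which `f_*` is injective. -/
abbrev BMChu := WideSubcategory (injectiveOnPoints.{u} unitInterval)

/-! ### Semiunitary maps -/

section Semiunitary

variable {H K L : Type*} [NormedAddCommGroup H] [InnerProductSpace ℂ H]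
  [NormedAddCommGroup K] [InnerProductSpace ℂ K] [NormedAddCommGroup L] [InnerProductSpace ℂ L]

/-- A bijective, additive, `σ`-homogeneous map with `⟪U φ, U ψ⟫ = σ ⟪φ, ψ⟫`. -/
structure IsUnitaryOver (σ : ℂ →+* ℂ) (U : H → K) : Prop where
  bijective : Function.Bijective U
  map_add : ∀ φ ψ, U (φ + ψ) = U φ + U ψ
  map_smul : ∀ (c : ℂ) (φ : H), U (c • φ) = σ c • U φ
  inner_map : ∀ φ ψ, inner ℂ (U φ) (U ψ) = σ (inner ℂ φ ψ)

/-- `U` is semiunitary: unitary (`σ` is the identity) or antiunitary (`σ` is conjugation). -/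
def IsSemiunitary (U : H → K) : Prop :=
  IsUnitaryOver (RingHom.id ℂ) U ∨ IsUnitaryOver (starRingEnd ℂ) U

theorem isSemiunitary_iff {U : H → K} : IsSemiunitary U ↔
    ∃ σ : ℂ →+* ℂ, (σ = RingHom.id ℂ ∨ σ = starRingEnd ℂ) ∧ IsUnitaryOver σ U := by
  constructor
  · rintro (h | h)
    · exact ⟨_, Or.inl rfl, h⟩
    · exact ⟨_, Or.inr rfl, h⟩
  · rintro ⟨σ, rfl | rfl, h⟩
    · exact Or.inl h
    · exact Or.inr h

theorem IsSemiunitary.refl : IsSemiunitary (id : H → H) :=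
  Or.inl ⟨Function.bijective_id, fun _ _ => rfl, fun _ _ => rfl, fun _ _ => rfl⟩

theorem IsUnitaryOver.comp {σ τ : ℂ →+* ℂ} {V : K → L} {U : H → K}
    (hV : IsUnitaryOver τ V) (hU : IsUnitaryOver σ U) : IsUnitaryOver (τ.comp σ) (V ∘ U) where
  bijective := hV.bijective.comp hU.bijective
  map_add φ ψ := by simp [hU.map_add, hV.map_add]
  map_smul c φ := by simp [hU.map_smul, hV.map_smul]
  inner_map φ ψ := by simp [hU.inner_map, hV.inner_map]

theorem IsSemiunitary.comp {V : K → L} {U : H → K} (hV : IsSemiunitary V)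
    (hU : IsSemiunitary U) : IsSemiunitary (V ∘ U) := by
  rw [isSemiunitary_iff] at *
  obtain ⟨τ, hτ, hV⟩ := hV
  obtain ⟨σ, hσ, hU⟩ := hU
  refine ⟨τ.comp σ, ?_, hV.comp hU⟩
  rcases hτ with rfl | rfl <;> rcases hσ with rfl | rfl <;> simp

theorem IsUnitaryOver.symm {σ : ℂ →+* ℂ} (hσ : ∀ c, σ (σ c) = c) {U : H → K}
    (hU : IsUnitaryOver σ U) :
    IsUnitaryOver σ (Equiv.ofBijective U hU.bijective).symm := by
  have key : ∀ x, U ((Equiv.ofBijective U hU.bijective).symm x) = x :=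
    (Equiv.ofBijective U hU.bijective).apply_symm_apply
  refine ⟨Equiv.bijective _, fun φ ψ => hU.bijective.1 ?_, fun c φ => hU.bijective.1 ?_,
    fun φ ψ => ?_⟩
  · simp only [hU.map_add, key]
  · simp only [hU.map_smul, key, hσ]
  · have h := hU.inner_map ((Equiv.ofBijective U hU.bijective).symm φ)
      ((Equiv.ofBijective U hU.bijective).symm ψ)
    rw [key, key] at h
    rw [h, hσ]

theorem IsSemiunitary.bijective {U : H → K} (hU : IsSemiunitary U) : Function.Bijective U :=
  hU.elim (fun h => h.bijective) (fun h => h.bijective)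

theorem IsSemiunitary.symm {U : H → K} (hU : IsSemiunitary U) :
    IsSemiunitary (Equiv.ofBijective U hU.bijective).symm :=
  hU.elim (fun h => Or.inl (h.symm fun _ => rfl))
    (fun h => Or.inr (h.symm fun c => Complex.conj_conj c))

theorem IsSemiunitary.map_zero {U : H → K} (hU : IsSemiunitary U) : U 0 = 0 := by
  obtain ⟨σ, -, h⟩ := isSemiunitary_iff.1 hU
  simpa using h.map_smul 0 0

theorem IsSemiunitary.map_ne_zero {U : H → K} (hU : IsSemiunitary U) {ψ : H} (hψ : ψ ≠ 0) :
    U ψ ≠ 0 :=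
  fun h => hψ (hU.bijective.1 (h.trans hU.map_zero.symm))

theorem IsSemiunitary.norm_map {U : H → K} (hU : IsSemiunitary U) (ψ : H) : ‖U ψ‖ = ‖ψ‖ := by
  obtain ⟨σ, hσ, h⟩ := isSemiunitary_iff.1 hU
  have h1 := h.inner_map ψ ψ
  have h2 : ‖U ψ‖ ^ 2 = ‖ψ‖ ^ 2 := by
    rw [inner_self_eq_norm_sq_to_K, inner_self_eq_norm_sq_to_K] at h1
    rcases hσ with rfl | rfl
    · simp only [RingHom.id_apply] at h1
      exact_mod_cast h1
    · rw [map_pow] at h1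
      simp only [Complex.coe_algebraMap, Complex.conj_ofReal] at h1
      exact_mod_cast h1
  exact (sq_eq_sq₀ (norm_nonneg _) (norm_nonneg _)).1 h2

theorem IsSemiunitary.map_sub {U : H → K} (hU : IsSemiunitary U) (φ ψ : H) :
    U (φ - ψ) = U φ - U ψ := by
  obtain ⟨σ, -, h⟩ := isSemiunitary_iff.1 hU
  rw [eq_sub_iff_add_eq, ← h.map_add, sub_add_cancel]

theorem IsSemiunitary.continuous {U : H → K} (hU : IsSemiunitary U) : Continuous U :=
  (Isometry.of_dist_eq fun x y => by
    rw [dist_eq_norm, dist_eq_norm, ← hU.map_sub, hU.norm_map]).continuous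

end Semiunitary

/-! ### The projective quantum symmetry groupoid -/

/-- The objects of `SymmH`: complex Hilbert spaces of dimension greater than two. -/
structure SymmH where
  /-- The underlying set of vectors. -/
  carrier : Type u
  [normedAddCommGroup : NormedAddCommGroup carrier]
  [innerProductSpace : InnerProductSpace ℂ carrier]
  [completeSpace : CompleteSpace carrier]
  two_lt_rank : 2 < Module.rank ℂ carrier

instance : CoeSort SymmH.{u} (Type u) := ⟨SymmH.carrier⟩

instance (H : SymmH.{u}) : NormedAddCommGroup H := H.normedAddCommGroup

instance (H : SymmH.{u}) : InnerProductSpace ℂ H := H.innerProductSpace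

instance (H : SymmH.{u}) : CompleteSpace H := H.completeSpace

/-- The morphisms of `SymmH`: semiunitary maps. -/
@[ext]
structure SymmH.Hom (H K : SymmH.{u}) where
  /-- The underlying map. -/
  toFun : H → K
  isSemiunitary : IsSemiunitary toFun

instance : Category SymmH.{u} where
  Hom H K := SymmH.Hom H K
  id H := ⟨id, IsSemiunitary.refl⟩
  comp U V := ⟨V.toFun ∘ U.toFun, V.isSemiunitary.comp U.isSemiunitary⟩

instance : Groupoid SymmH.{u} where
  inv U := ⟨(Equiv.ofBijective U.toFun U.isSemiunitary.bijective).symm, U.isSemiunitary.symm⟩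
  inv_comp U := SymmH.Hom.ext (funext
    (Equiv.ofBijective U.toFun U.isSemiunitary.bijective).apply_symm_apply)
  comp_inv U := SymmH.Hom.ext (funext
    (Equiv.ofBijective U.toFun U.isSemiunitary.bijective).symm_apply_apply)

/-- `U ∼ V` iff `U = λ V` for some `λ` in the circle group `U(1)`. -/
def phaseRel : HomRel SymmH.{u} :=
  fun _ _ U V => ∃ c : Circle, ∀ ψ, U.toFun ψ = (c : ℂ) • V.toFun ψ

instance : Congruence phaseRel.{u} where
  equivalence := by
    refine ⟨fun U => ⟨1, fun ψ => by simp⟩, ?_, ?_⟩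
    · rintro U V ⟨c, h⟩
      exact ⟨c⁻¹, fun ψ => by rw [h, smul_smul, ← Circle.coe_mul]; simp⟩
    · rintro U V W ⟨c, h⟩ ⟨d, h'⟩
      exact ⟨c * d, fun ψ => by rw [h, h', smul_smul, Circle.coe_mul]⟩
  comp_left := by
    rintro _ _ _ f g g' ⟨c, h⟩
    exact ⟨c, fun ψ => h (f.toFun ψ)⟩
  comp_right := by
    rintro _ _ _ f f' g ⟨c, h⟩
    have e : ∀ ψ, (f ≫ g).toFun ψ = g.toFun ((c : ℂ) • f'.toFun ψ) :=
      fun ψ => congrArg g.toFun (h ψ)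
    rcases g.isSemiunitary with hg | hg
    · exact ⟨c, fun ψ => (e ψ).trans (hg.map_smul _ _)⟩
    · refine ⟨c⁻¹, fun ψ => ((e ψ).trans (hg.map_smul _ _)).trans ?_⟩
      rw [Circle.coe_inv_eq_conj]
      rfl

/-- The projective quantum symmetry groupoid `ℙSymmH`: the objects of `SymmH`, with the
semiunitaries modulo phase as morphisms. -/
abbrev PSymmH := CategoryTheory.Quotient phaseRel.{u}

/-- The quotient functor from `SymmH` to `ℙSymmH`. -/
abbrev toPSymmH : SymmH.{u} ⥤ PSymmH.{u} := Quotient.functor phaseRel.{u}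

/-! ### The Chu space of a Hilbert space -/

section Evaluation

variable {H K : Type*} [NormedAddCommGroup H] [InnerProductSpace ℂ H] [CompleteSpace H]
  [NormedAddCommGroup K] [InnerProductSpace ℂ K] [CompleteSpace K]

instance (S : ClosedSubmodule ℂ H) : CompleteSpace S.toSubmodule :=
  S.isClosed'.completeSpace_coe

/-- The statistical algorithm `e(ψ, S) = ‖P_S ψ‖² / ‖ψ‖²`, as an element of `[0, 1]`. -/
def eval (ψ : H) (S : ClosedSubmodule ℂ H) : unitInterval :=
  ⟨‖S.toSubmodule.starProjection ψ‖ ^ 2 / ‖ψ‖ ^ 2, by positivity,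
    div_le_one_of_le₀
      (pow_le_pow_left₀ (norm_nonneg _) (S.toSubmodule.norm_starProjection_apply_le ψ) 2)
      (by positivity)⟩

theorem eval_smul {c : ℂ} (hc : c ≠ 0) (ψ : H) (S : ClosedSubmodule ℂ H) :
    eval (c • ψ) S = eval ψ S := by
  apply Subtype.ext
  have h : ‖c‖ ^ 2 ≠ 0 := pow_ne_zero 2 (norm_ne_zero_iff.2 hc)
  simp only [eval, map_smul, norm_smul, mul_pow]
  exact mul_div_mul_left _ _ h

theorem eval_eq_one_iff {ψ : H} (hψ : ψ ≠ 0) (S : ClosedSubmodule ℂ H) :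
    eval ψ S = 1 ↔ ψ ∈ S := by
  have h : ‖ψ‖ ^ 2 ≠ 0 := pow_ne_zero 2 (norm_ne_zero_iff.2 hψ)
  rw [Subtype.ext_iff]
  simp only [eval, Set.Icc.coe_one]
  rw [div_eq_one_iff_eq h, sq_eq_sq₀ (norm_nonneg _) (norm_nonneg _)]
  exact (S.toSubmodule.mem_iff_norm_starProjection ψ).symm

/-- The evaluation `ē([ψ], S) = e(ψ, S)` on rays. -/
def rayEval (p : Projectivization ℂ H) (S : ClosedSubmodule ℂ H) : unitInterval :=
  Projectivization.lift (fun ψ => eval ψ.1 S) (by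
    rintro ⟨a, ha⟩ ⟨b, hb⟩ t (rfl : a = t • b)
    exact eval_smul (left_ne_zero_of_smul ha) b S) p

/-- The action `P(U)` of a semiunitary on rays, `[ψ] ↦ [U ψ]`. -/
def rayMap (U : H → K) (hU : IsSemiunitary U) : Projectivization ℂ H → Projectivization ℂ K :=
  Projectivization.lift (fun ψ => Projectivization.mk ℂ (U ψ.1) (hU.map_ne_zero ψ.2)) (by
    rintro ⟨a, ha⟩ ⟨b, hb⟩ t (rfl : a = t • b)
    obtain ⟨σ, -, h⟩ := isSemiunitary_iff.1 hU
    exact (Projectivization.mk_eq_mk_iff' ℂ _ _ _ _).2 ⟨σ t, (h.map_smul t b).symm⟩)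

/-- The inverse image `U⁻¹(S)` of a closed subspace under a semiunitary. -/
def preimage (U : H → K) (hU : IsSemiunitary U) (S : ClosedSubmodule ℂ K) :
    ClosedSubmodule ℂ H where
  carrier := U ⁻¹' S
  add_mem' {a b} ha hb := by
    obtain ⟨σ, -, h⟩ := isSemiunitary_iff.1 hU
    rw [Set.mem_preimage, h.map_add]
    exact S.toSubmodule.add_mem ha hb
  zero_mem' := by
    rw [Set.mem_preimage, hU.map_zero]
    exact S.toSubmodule.zero_mem
  smul_mem' c a ha := by
    obtain ⟨σ, -, h⟩ := isSemiunitary_iff.1 hU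
    rw [Set.mem_preimage, h.map_smul]
    exact S.toSubmodule.smul_mem _ ha
  isClosed' := S.isClosed'.preimage hU.continuous

theorem starProjection_map (U : H → K) (hU : IsSemiunitary U) (S : ClosedSubmodule ℂ K) (ψ : H) :
    S.toSubmodule.starProjection (U ψ) =
      U ((preimage U hU S).toSubmodule.starProjection ψ) := by
  obtain ⟨σ, -, h⟩ := isSemiunitary_iff.1 hU
  refine Submodule.eq_starProjection_of_mem_of_inner_eq_zero
    ((preimage U hU S).toSubmodule.starProjection_apply_mem ψ) fun w hw => ?_
  obtain ⟨v, rfl⟩ := h.bijective.2 w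
  rw [← hU.map_sub, h.inner_map,
    Submodule.starProjection_inner_eq_zero ψ v (show v ∈ (preimage U hU S).toSubmodule from hw),
    map_zero]

theorem eval_preimage (U : H → K) (hU : IsSemiunitary U) (ψ : H) (S : ClosedSubmodule ℂ K) :
    eval ψ (preimage U hU S) = eval (U ψ) S := by
  apply Subtype.ext
  simp only [eval, starProjection_map U hU, hU.norm_map]

end Evaluation

/-- The Chu space `(P(H), L(H), ē_H)` over `[0, 1]`: rays, closed subspaces, and evaluation. -/
def rayChu (H : SymmH.{u}) : Chu.{u} unitInterval where
  Pt := Projectivization ℂ H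
  At := ClosedSubmodule ℂ H
  eval := rayEval

theorem rayChu_isBiextensional (H : SymmH.{u}) :
    Chu.IsBiextensional unitInterval (rayChu H) := by
  constructor
  · intro (S : ClosedSubmodule ℂ H) (T : ClosedSubmodule ℂ H) h
    refine SetLike.ext (p := S) (q := T) fun ψ => ?_
    by_cases hψ : ψ = 0
    · subst hψ
      exact iff_of_true S.toSubmodule.zero_mem T.toSubmodule.zero_mem
    · have h' : eval ψ S = eval ψ T := h (Projectivization.mk ℂ ψ hψ)
      rw [← eval_eq_one_iff hψ, ← eval_eq_one_iff hψ, h']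
  · intro (p : Projectivization ℂ H) (q : Projectivization ℂ H) h
    induction p using Projectivization.ind with | h φ hφ
    induction q using Projectivization.ind with | h ψ hψ
    let S : ClosedSubmodule ℂ H := ⟨ℂ ∙ ψ, Submodule.closed_of_finiteDimensional _⟩
    have h' : eval φ S = eval ψ S := h S
    have h1 : eval ψ S = 1 := (eval_eq_one_iff hψ S).2 (Submodule.mem_span_singleton_self ψ)
    have h2 : φ ∈ S := (eval_eq_one_iff hφ S).1 (h'.trans h1)
    exact (Projectivization.mk_eq_mk_iff' ℂ _ _ _ _).2 (Submodule.mem_span_singleton.1 h2)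

/-- The Chu morphism `(P(U), U⁻¹)`. -/
def rayChuMap {H K : SymmH.{u}} (U : H ⟶ K) : rayChu H ⟶ rayChu K where
  pt := rayMap U.toFun U.isSemiunitary
  at' := preimage U.toFun U.isSemiunitary
  eval_eq p S := by
    induction p using Projectivization.ind with | h ψ hψ
    exact eval_preimage U.toFun U.isSemiunitary ψ S

theorem rayMap_injective {H K : SymmH.{u}} (U : H ⟶ K) :
    Function.Injective (rayMap U.toFun U.isSemiunitary) := by
  intro p q h
  induction p using Projectivization.ind with | h φ hφ
  induction q using Projectivization.ind with | h ψ hψ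
  obtain ⟨t, ht⟩ := (Projectivization.mk_eq_mk_iff' ℂ _ _ _ _).1 h
  rcases U.isSemiunitary with hU | hU
  · exact (Projectivization.mk_eq_mk_iff' ℂ _ _ _ _).2
      ⟨t, hU.bijective.1 ((hU.map_smul t ψ).trans ht)⟩
  · refine (Projectivization.mk_eq_mk_iff' ℂ _ _ _ _).2
      ⟨starRingEnd ℂ t, hU.bijective.1 ((hU.map_smul _ ψ).trans ?_)⟩
    rw [Complex.conj_conj]
    exact ht

/-- The functor `H ↦ (P(H), L(H), ē_H)`, `U ↦ (P(U), U⁻¹)` on `SymmH`. -/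
def QR : SymmH.{u} ⥤ BMChu.{u} where
  obj H := ⟨⟨rayChu H, rayChu_isBiextensional H⟩⟩
  map U := ⟨⟨rayChuMap U⟩, rayMap_injective U⟩
  map_id H := by
    apply WideSubcategory.hom_ext
    apply InducedCategory.Hom.ext
    refine Chu.Hom.ext (funext fun p => ?_) (funext fun S => rfl)
    induction p using Projectivization.ind with | h ψ hψ
    rfl
  map_comp U V := by
    apply WideSubcategory.hom_ext
    apply InducedCategory.Hom.ext
    refine Chu.Hom.ext (funext fun p => ?_) (funext fun S => rfl)
    induction p using Projectivization.ind with | h ψ hψ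
    rfl

theorem QR_map_eq_of_phaseRel (H K : SymmH.{u}) (U V : H ⟶ K) (h : phaseRel U V) :
    QR.map U = QR.map V := by
  obtain ⟨c, hc⟩ := h
  apply WideSubcategory.hom_ext
  apply InducedCategory.Hom.ext
  refine Chu.Hom.ext (funext fun p => ?_)
    (funext fun (S : ClosedSubmodule ℂ K) => ?_)
  · induction p using Projectivization.ind with | h ψ hψ
    exact (Projectivization.mk_eq_mk_iff' ℂ _ _ _ _).2 ⟨c, (hc ψ).symm⟩
  · refine SetLike.ext (p := preimage U.toFun U.isSemiunitary S)
      (q := preimage V.toFun V.isSemiunitary S) fun (ψ : H) => ?_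
    change U.toFun ψ ∈ S.toSubmodule ↔ V.toFun ψ ∈ S.toSubmodule
    rw [hc ψ]
    exact Submodule.smul_mem_iff _ c.coe_ne_zero

/-- The functor `PR` from the projective quantum symmetry groupoid to `bmChu`, induced on
semiunitaries modulo phase by `U ↦ (P(U), U⁻¹)`. -/
def PR : PSymmH.{u} ⥤ BMChu.{u} :=
  CategoryTheory.Quotient.lift phaseRel QR QR_map_eq_of_phaseRel

end QuantumChu

end

noncomputable section

namespace QuantumChu

open CategoryTheory

/-! Fullness is Wigner's theorem in disguise. Evaluating to 1 on a ray means containing it, so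
injectivity of `f_*` forces `f^*` to send the line of `f_*[φ]` back to the line of `φ`
(`adjoint_line`); adjointness then says that `f_*` preserves transition probabilities. Wigner's
theorem, in a form that does not assume surjectivity (`exists_semilinear_of_norm_inner_eq`), lifts
`f_*` to a linear or conjugate-linear isometry.

Surjectivity also comes from adjointness: a ray of the target is either hit or orthogonal to the
whole image, and a sum of one vector of each kind would be neither (`surjective_of_adjoint`). The
attribute map needs no separate treatment, since extensionality of the source makes `f_*` determine
`f^*`.

For faithfulness, `U ψ = c(ψ) V ψ` on nonzero vectors. Additivity makes `c` agree on orthogonal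
vectors, and dimension greater than 2 supplies a vector orthogonal to any two given ones, so `c` is
constant. -/

theorem forall_mem_or_forall_mem_of_cover {G : Type*} [AddGroup G] (A B : AddSubgroup G)
    (h : ∀ x, x ∈ A ∨ x ∈ B) : (∀ x, x ∈ A) ∨ ∀ x, x ∈ B := by
  by_contra! hc
  obtain ⟨⟨x, hx⟩, y, hy⟩ := hc
  have hxB := (h x).resolve_left hx
  have hyA := (h y).resolve_right hy
  rcases h (x + y) with hA | hB
  · exact hx ((A.add_mem_cancel_right hyA).1 hA)
  · exact hy ((B.add_mem_cancel_left hxB).1 hB)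

/-! ### Wigner's theorem without surjectivity -/

section Wigner

variable {H K : Type*} [NormedAddCommGroup H] [InnerProductSpace ℂ H]
  [NormedAddCommGroup K] [InnerProductSpace ℂ K]

/-- Expanding `‖u - v‖²` gives `r + r - 2r = 0`. This turns algebraic identities for a map into
computations with real parts of inner products. -/
theorem eq_of_re_inner_eq {u v : K} {r : ℝ} (hu : (inner ℂ u u).re = r)
    (hv : (inner ℂ v v).re = r) (huv : (inner ℂ u v).re = r) : u = v := by
  have hvu : (inner ℂ v u).re = r := by
    rw [← inner_conj_symm, Complex.conj_re, huv]
  rw [← sub_eq_zero, ← norm_eq_zero, ← sq_eq_zero_iff, ← inner_self_eq_norm_sq (𝕜 := ℂ)]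
  simp only [inner_sub_left, inner_sub_right, map_sub, RCLike.re_eq_complex_re, hu, hv, huv, hvu]
  ring

/-- The equality case of Cauchy–Schwarz; equal norms force the scalar onto the unit circle. -/
theorem exists_norm_one_smul_eq {u v : K} (hn : ‖u‖ = ‖v‖)
    (h : ‖inner ℂ v u‖ = ‖v‖ * ‖u‖) : ∃ c : ℂ, ‖c‖ = 1 ∧ u = c • v := by
  by_cases hv : v = 0
  · subst hv
    exact ⟨1, by simp, by simpa using hn⟩
  · have hu : u ≠ 0 := by
      rw [← norm_ne_zero_iff, hn]
      exact norm_ne_zero_iff.2 hv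
    obtain ⟨c, -, hc⟩ := (norm_inner_eq_norm_iff hv hu).1 h
    refine ⟨c, ?_, hc⟩
    rw [hc, norm_smul] at hn
    exact (mul_eq_right₀ (norm_ne_zero_iff.2 hv)).1 hn

/-- A map preserving the real parts and the absolute values of inner products is linear or
conjugate linear. -/
theorem semilinear_of_re_inner {V : H → K}
    (hre : ∀ x y, (inner ℂ (V x) (V y)).re = (inner ℂ x y).re)
    (habs : ∀ x y, ‖inner ℂ (V x) (V y)‖ = ‖inner ℂ x y‖) :
    (∀ x y, V (x + y) = V x + V y) ∧ ∃ σ : ℂ →+* ℂ, (σ = RingHom.id ℂ ∨ σ = starRingEnd ℂ) ∧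
      (∀ (c : ℂ) (x : H), V (c • x) = σ c • V x) ∧
      ∀ x y, inner ℂ (V x) (V y) = σ (inner ℂ x y) := by
  have hadd : ∀ x y, V (x + y) = V x + V y := by
    intro x y
    refine eq_of_re_inner_eq (hre _ _) ?_ ?_ <;>
      simp only [inner_add_left, inner_add_right, Complex.add_re, hre]
  have hreal : ∀ (r : ℝ) x, V ((r : ℂ) • x) = (r : ℂ) • V x := by
    intro r x
    refine eq_of_re_inner_eq (hre _ _) ?_ ?_ <;>
      simp only [inner_smul_left, inner_smul_right, Complex.conj_ofReal, Complex.re_ofReal_mul, hre]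
  have hself : ∀ x, inner ℂ (V x) (V x) = inner ℂ x x := by
    intro x
    have h := hre x x
    rw [inner_self_eq_norm_sq_to_K, inner_self_eq_norm_sq_to_K] at h ⊢
    norm_cast at h ⊢
  -- The inner product of `V (i x)` with `V x` has real part 0 and modulus `‖x‖²`, so it is
  -- `∓i‖x‖²`; the sign decides between the two alternatives.
  have hI : ∀ x, V (Complex.I • x) = Complex.I • V x ∨ V (Complex.I • x) = -(Complex.I • V x) := by
    intro x
    have h1 := hre (Complex.I • x) x
    have h2 := habs (Complex.I • x) x
    have h3 : inner ℂ x x = ((‖x‖ ^ 2 : ℝ) : ℂ) := by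
      rw [inner_self_eq_norm_sq_to_K]; norm_cast
    have h4 : (inner ℂ (V (Complex.I • x)) (V x)).im = -‖x‖ ^ 2 ∨
        (inner ℂ (V (Complex.I • x)) (V x)).im = ‖x‖ ^ 2 := by
      rw [inner_smul_left, h3] at h1 h2
      have h5 : (inner ℂ (V (Complex.I • x)) (V x)).re = 0 := by
        rw [h1]; simp [-Complex.ofReal_pow]
      have h6 : ‖inner ℂ (V (Complex.I • x)) (V x)‖ ^ 2 = (‖x‖ ^ 2) ^ 2 := by
        rw [h2]; simp
      rw [Complex.sq_norm, Complex.normSq_apply, h5] at h6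
      rw [mul_zero, zero_add, ← pow_two] at h6
      exact (sq_eq_sq_iff_eq_or_eq_neg.1 h6).symm
    have h7 : (inner ℂ (V (Complex.I • x)) (V (Complex.I • x))).re = ‖x‖ ^ 2 := by
      rw [hre, inner_smul_left, inner_smul_right, h3]
      simp [-Complex.ofReal_pow]
    refine h4.imp (fun h => eq_of_re_inner_eq h7 ?_ ?_) (fun h => eq_of_re_inner_eq h7 ?_ ?_)
    · rw [inner_smul_left, inner_smul_right, hself, h3]
      simp [-Complex.ofReal_pow]
    · simp [h]
    · rw [inner_neg_neg, inner_smul_left, inner_smul_right, hself, h3]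
      simp [-Complex.ofReal_pow]
    · simp [inner_smul_right, h]
  have hzero : V 0 = 0 := by simpa using hadd 0 0
  have hneg : ∀ x, V (-x) = -V x := by
    intro x
    have h := hadd x (-x)
    rw [add_neg_cancel, hzero] at h
    exact eq_neg_of_add_eq_zero_right h.symm
  have hdec : ∀ (c : ℂ) x, V (c • x) = (c.re : ℂ) • V x + (c.im : ℂ) • V (Complex.I • x) := by
    intro c x
    rw [← hreal, ← hreal, ← hadd, smul_smul, ← add_smul, Complex.re_add_im]
  have him : ∀ x y : H, (inner ℂ x y).im = (inner ℂ (Complex.I • x) y).re := by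
    intro x y
    simp
  have himK : ∀ x y : K, (inner ℂ x y).im = (inner ℂ (Complex.I • x) y).re := by
    intro x y
    simp
  refine ⟨hadd, ?_⟩
  -- A priori the sign depends on `x`. Each sign holds on an additive subgroup, and a group is not
  -- the union of two proper subgroups.
  rcases forall_mem_or_forall_mem_of_cover
    (⟨⟨⟨{x | V (Complex.I • x) = Complex.I • V x}, fun {x y} hx hy => by
        rw [Set.mem_ofPred_eq] at *; rw [smul_add, hadd, hadd, hx, hy, smul_add]⟩,
        by simp [hzero]⟩, fun {x} hx => by
        simp only [Set.mem_ofPred_eq] at *; rw [smul_neg, hneg, hneg, hx, smul_neg]⟩ :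
          AddSubgroup H)
    (⟨⟨⟨{x | V (Complex.I • x) = -(Complex.I • V x)}, fun {x y} hx hy => by
        rw [Set.mem_ofPred_eq] at *; rw [smul_add, hadd, hadd, hx, hy, smul_add, neg_add]⟩,
        by simp [hzero]⟩, fun {x} hx => by
        simp only [Set.mem_ofPred_eq] at *; rw [smul_neg, hneg, hneg, hx, smul_neg]⟩ :
          AddSubgroup H) hI with h | h
  · replace h : ∀ x, V (Complex.I • x) = Complex.I • V x := h
    refine ⟨_, Or.inl rfl, fun c x => ?_, fun x y => Complex.ext (hre x y) ?_⟩
    · rw [hdec, h, smul_smul, ← add_smul, Complex.re_add_im, RingHom.id_apply]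
    · rw [himK, ← h, hre, RingHom.id_apply, him]
  · replace h : ∀ x, V (Complex.I • x) = -(Complex.I • V x) := h
    refine ⟨_, Or.inr rfl, fun c x => ?_, fun x y => Complex.ext ?_ ?_⟩
    · rw [hdec, h, ← neg_smul, smul_smul, ← add_smul]
      congr 1
      apply Complex.ext <;> simp
    · rw [hre, Complex.conj_re]
    · rw [himK, Complex.conj_im, him, ← hre, h, inner_neg_left, Complex.neg_re, neg_neg]

/-- **Wigner's theorem** for maps that need not be surjective. -/
theorem exists_semilinear_of_norm_inner_eq {T : H → K}
    (hT : ∀ x y, ‖inner ℂ (T x) (T y)‖ = ‖inner ℂ x y‖) {e : H} (he : ‖e‖ = 1) :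
    ∃ U : H → K, (∀ x y, U (x + y) = U x + U y) ∧
      (∃ σ : ℂ →+* ℂ, (σ = RingHom.id ℂ ∨ σ = starRingEnd ℂ) ∧
        (∀ (c : ℂ) (x : H), U (c • x) = σ c • U x) ∧
        ∀ x y, inner ℂ (U x) (U y) = σ (inner ℂ x y)) ∧
      ∀ x, ∃ c : ℂ, ‖c‖ = 1 ∧ U x = c • T x := by
  have hnorm : ∀ x, ‖T x‖ = ‖x‖ := by
    intro x
    have h := hT x x
    rw [inner_self_eq_norm_sq_to_K, inner_self_eq_norm_sq_to_K, norm_pow, norm_pow] at h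
    exact (sq_eq_sq₀ (norm_nonneg _) (norm_nonneg _)).1 (by simpa using h)
  have hee : inner ℂ e e = 1 := by rw [inner_self_eq_norm_sq_to_K, he]; simp
  have hTe : inner ℂ (T e) (T e) = 1 := by rw [inner_self_eq_norm_sq_to_K, hnorm, he]; simp
  let E := (ℂ ∙ e)ᗮ
  have hE : ∀ x : E, inner ℂ e (x : H) = 0 := fun x =>
    Submodule.mem_orthogonal_singleton_iff_inner_right.1 x.2
  have hE' : ∀ x : E, inner ℂ (x : H) e = 0 := fun x =>
    Submodule.mem_orthogonal_singleton_iff_inner_left.1 x.2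
  have hTE : ∀ x : E, inner ℂ (T e) (T x) = 0 := fun x => by
    rw [← norm_eq_zero, hT, hE, norm_zero]
  -- The phase normalizing `T (e + x)` to have inner product 1 with `T e`. Thus `T e + V x`
  -- represents the image of the ray of `e + x`, with `V x` orthogonal to `T e`.
  let c : E → ℂ := fun x => (inner ℂ (T e) (T (e + x)))⁻¹
  have hin : ∀ x : E, ‖inner ℂ (T e) (T (e + x))‖ = 1 := fun x => by
    rw [hT, inner_add_right, hE, hee]; simp
  have hc : ∀ x, ‖c x‖ = 1 := fun x => by simp only [c, norm_inv, hin, inv_one]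
  let V : E → K := fun x => c x • T (e + x) - T e
  have hV : ∀ x, T e + V x = c x • T (e + x) := fun x => by simp [V]
  have hVe : ∀ x, inner ℂ (T e) (V x) = 0 := fun x => by
    simp only [V, inner_sub_right, inner_smul_right, hTe, c]
    rw [inv_mul_cancel₀, sub_self]
    rw [← norm_ne_zero_iff, hin]; exact one_ne_zero
  have hVe' : ∀ x, inner ℂ (V x) (T e) = 0 := fun x => by
    rw [← inner_conj_symm, hVe, map_zero]
  have hone : ∀ x y : E, ‖1 + inner ℂ (V x) (V y)‖ = ‖1 + inner ℂ x y‖ := by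
    intro x y
    have h1 : inner ℂ (T e + V x) (T e + V y) = 1 + inner ℂ (V x) (V y) := by
      rw [inner_add_left, inner_add_right, inner_add_right, hVe, hVe', hTe, add_zero, zero_add]
    have h2 : inner ℂ (e + x : H) (e + y : H) = 1 + inner ℂ x y := by
      rw [inner_add_left, inner_add_right, inner_add_right, hE, hE', hee, add_zero, zero_add]; rfl
    rw [← h1, hV, hV, inner_smul_left, inner_smul_right, norm_mul, norm_mul, RCLike.norm_conj, hc,
      hc, one_mul, one_mul, hT, h2]
  have hVT : ∀ x y : E, ‖inner ℂ (V x) (T y)‖ = ‖inner ℂ x y‖ := by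
    intro x y
    have h1 : inner ℂ (T e + V x) (T y) = inner ℂ (V x) (T y) := by
      rw [inner_add_left, hTE, zero_add]
    have h2 : inner ℂ (e + x : H) (y : H) = inner ℂ x y := by
      rw [inner_add_left, hE, zero_add]; rfl
    rw [← h1, hV, inner_smul_left, norm_mul, RCLike.norm_conj, hc, one_mul, hT, h2]
  have hVnorm : ∀ x, ‖V x‖ = ‖x‖ := by
    intro x
    have h := hone x x
    rw [inner_self_eq_norm_sq_to_K, inner_self_eq_norm_sq_to_K] at h
    simp only [Complex.coe_algebraMap, ← Complex.ofReal_pow, ← Complex.ofReal_one,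
      ← Complex.ofReal_add, Complex.norm_real] at h
    rw [Real.norm_of_nonneg (by positivity), Real.norm_of_nonneg (by positivity)] at h
    exact (sq_eq_sq₀ (norm_nonneg _) (norm_nonneg _)).1 (add_left_cancel h)
  -- Equality in Cauchy–Schwarz, by `hVT` and the equality of norms: `V` is a rephasing of `T` on
  -- `E`, so it inherits the moduli of inner products.
  have hVd : ∀ x : E, ∃ d : ℂ, ‖d‖ = 1 ∧ V x = d • T x := by
    intro x
    have h1 : ‖V x‖ = ‖T x‖ := by rw [hVnorm, hnorm]; rfl
    refine exists_norm_one_smul_eq h1 ?_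
    rw [norm_inner_symm, hVT, hVnorm, hnorm, inner_self_eq_norm_sq_to_K]
    simp [pow_two]
  have habs : ∀ x y, ‖inner ℂ (V x) (V y)‖ = ‖inner ℂ x y‖ := by
    intro x y
    obtain ⟨d, hd, h⟩ := hVd y
    rw [h, inner_smul_right, norm_mul, hd, one_mul, hVT]
  -- Since `|1 + z|² = 1 + 2 Re z + |z|²`, knowing both `|1 + z|` and `|z|` determines `Re z`.
  have hre : ∀ x y, (inner ℂ (V x) (V y)).re = (inner ℂ x y).re := by
    intro x y
    have h1 := congrArg (· ^ 2) (hone x y)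
    have h2 := congrArg (· ^ 2) (habs x y)
    simp only [Complex.sq_norm, Complex.normSq_apply, Complex.add_re, Complex.add_im,
      Complex.one_re, Complex.one_im] at h1 h2
    linarith
  obtain ⟨hadd, σ, hσ, hsmul, hinner⟩ := semilinear_of_re_inner hre habs
  let p : H →L[ℂ] E := E.orthogonalProjectionOnto
  have hp : ∀ h, h = inner ℂ e h • e + (p h : H) := by
    intro h
    have h1 : (p h : H) = h - (ℂ ∙ e).starProjection h := by
      rw [← Submodule.starProjection_orthogonal_val]; rfl
    rw [h1, Submodule.starProjection_unit_singleton ℂ he]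
    abel
  have hcσ : ∀ z, starRingEnd ℂ (σ z) = σ (starRingEnd ℂ z) := by
    rcases hσ with rfl | rfl <;> simp
  have hnσ : ∀ z, ‖σ z‖ = ‖z‖ := by
    rcases hσ with rfl | rfl <;> simp
  -- `V` lives only on the complement of `e`; it is extended along `e` with the same `σ`.
  refine ⟨fun h => σ (inner ℂ e h) • T e + V (p h), fun x y => ?_, ⟨σ, hσ, fun c x => ?_,
    fun x y => ?_⟩, fun x => ?_⟩
  · simp only [inner_add_right, map_add, add_smul, hadd]
    abel
  · simp only [inner_smul_right, map_mul, map_smul, hsmul, smul_add, smul_smul]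
  · conv_rhs => rw [hp x, hp y]
    simp only [inner_add_left, inner_add_right, inner_smul_left, inner_smul_right, hTe, hVe, hVe',
      hinner, hE, hE', hee, hcσ, map_add, map_mul, map_one, mul_zero, zero_add, add_zero]
    rfl
  · by_cases hx : inner ℂ e x = 0
    · obtain ⟨d, hd, h⟩ := hVd (p x)
      have hpx : (p x : H) = x := by
        conv_rhs => rw [hp x, hx, zero_smul, zero_add]
      exact ⟨d, hd, by simp only [hx, map_zero, zero_smul, zero_add, h, hpx]⟩
    -- Rescaling by `l⁻¹` brings `x` to the form `e + y` with `y` in `E`, where `hV` applies.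
    · set l := inner ℂ e x with hl
      have h1 : σ l • T e + V (p x) = σ l • c (l⁻¹ • p x) • T (l⁻¹ • x) := by
        have h2 : l⁻¹ • x = e + ((l⁻¹ • p x : E) : H) := by
          conv_lhs => rw [hp x]
          rw [smul_add, smul_smul, ← hl, inv_mul_cancel₀ hx, one_smul]; rfl
        rw [h2, ← hV, hsmul, smul_add, smul_smul, ← map_mul, mul_inv_cancel₀ hx, map_one, one_smul]
      have hlx : ‖l‖ * ‖l⁻¹‖ = 1 := by rw [← norm_mul, mul_inv_cancel₀ hx, norm_one]
      dsimp only
      rw [h1]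
      refine exists_norm_one_smul_eq ?_ ?_
      · rw [norm_smul, norm_smul, hc, one_mul, hnorm, hnorm, norm_smul, hnσ, ← mul_assoc, hlx,
          one_mul]
      · rw [inner_smul_right, inner_smul_right, norm_mul, norm_mul, norm_smul, norm_smul, hT, hc,
          hnorm, hnorm, norm_smul, inner_smul_right, norm_mul, inner_self_eq_norm_sq_to_K]
        simp only [norm_pow, Complex.coe_algebraMap, Complex.norm_real, norm_norm]
        ring

end Wigner

/-! ### From Chu morphisms to semiunitaries -/

section RayMaps

variable {H K : Type*} [NormedAddCommGroup H] [InnerProductSpace ℂ H] [CompleteSpace H]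
  [NormedAddCommGroup K] [InnerProductSpace ℂ K] [CompleteSpace K]

/-- The closed subspace spanned by a vector. -/
def line (φ : H) : ClosedSubmodule ℂ H :=
  ⟨ℂ ∙ φ, Submodule.closed_of_finiteDimensional _⟩

theorem eval_line (ψ φ : H) :
    (eval ψ (line φ) : ℝ) = ‖inner ℂ φ ψ‖ ^ 2 / (‖φ‖ ^ 2 * ‖ψ‖ ^ 2) := by
  have h : (line φ).toSubmodule.starProjection ψ = (inner ℂ φ ψ / ((‖φ‖ ^ 2 : ℝ) : ℂ)) • φ := by
    exact Submodule.starProjection_singleton ℂ ψ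
  simp only [eval, h, norm_smul, norm_div, Complex.norm_real]
  by_cases hφ : φ = 0
  · simp [hφ]
  by_cases hψ : ψ = 0
  · simp [hψ]
  have h1 := norm_ne_zero_iff.2 hφ
  have h2 := norm_ne_zero_iff.2 hψ
  rw [norm_pow, norm_norm]
  field_simp

theorem eval_line_eq_one_iff {ψ φ : H} (hψ : ψ ≠ 0) (hφ : φ ≠ 0) :
    eval ψ (line φ) = 1 ↔ Projectivization.mk ℂ ψ hψ = Projectivization.mk ℂ φ hφ := by
  rw [eval_eq_one_iff hψ, Projectivization.mk_eq_mk_iff']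
  exact Submodule.mem_span_singleton

theorem rayEval_line_eq_one_iff (p : Projectivization ℂ H) {φ : H} (hφ : φ ≠ 0) :
    rayEval p (line φ) = 1 ↔ p = Projectivization.mk ℂ φ hφ := by
  induction p using Projectivization.ind with | h ψ hψ
  exact eval_line_eq_one_iff hψ hφ

theorem eq_line_of_rayEval_eq_one_iff {S : ClosedSubmodule ℂ H} {φ : H} (hφ : φ ≠ 0)
    (h : ∀ p, rayEval p S = 1 ↔ p = Projectivization.mk ℂ φ hφ) : S = line φ := by
  refine SetLike.ext fun ψ => ?_
  by_cases hψ : ψ = 0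
  · subst hψ
    exact iff_of_true S.toSubmodule.zero_mem (line φ).toSubmodule.zero_mem
  · rw [← eval_eq_one_iff hψ, ← eval_eq_one_iff hψ, eval_line_eq_one_iff hψ hφ]
    exact h (Projectivization.mk ℂ ψ hψ)

variable {f : Projectivization ℂ H → Projectivization ℂ K}
  {g : ClosedSubmodule ℂ K → ClosedSubmodule ℂ H}

/-- `g (line φ')` takes the value 1 at `p` exactly when `f p = f [φ]`, which by injectivity means `p
= [φ]`; a closed subspace is determined by the rays where it evaluates to 1. -/
theorem adjoint_line (hf : Function.Injective f) (hfg : ∀ p S, rayEval p (g S) = rayEval (f p) S)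
    {φ : H} (hφ : φ ≠ 0) {φ' : K} (hφ' : φ' ≠ 0)
    (h : f (Projectivization.mk ℂ φ hφ) = Projectivization.mk ℂ φ' hφ') :
    g (line φ') = line φ :=
  eq_line_of_rayEval_eq_one_iff hφ fun p => by
    rw [hfg, rayEval_line_eq_one_iff _ hφ', ← h, hf.eq_iff]

/-- The map on points preserves transition probabilities. -/
theorem eval_line_eq (hf : Function.Injective f)
    (hfg : ∀ p S, rayEval p (g S) = rayEval (f p) S)
    {φ ψ : H} (hφ : φ ≠ 0) (hψ : ψ ≠ 0) {φ' ψ' : K} (hφ' : φ' ≠ 0) (hψ' : ψ' ≠ 0)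
    (h : f (Projectivization.mk ℂ φ hφ) = Projectivization.mk ℂ φ' hφ')
    (h' : f (Projectivization.mk ℂ ψ hψ) = Projectivization.mk ℂ ψ' hψ') :
    eval ψ (line φ) = eval ψ' (line φ') := by
  have h1 := hfg (Projectivization.mk ℂ ψ hψ) (line φ')
  rw [h', adjoint_line hf hfg hφ hφ' h] at h1
  exact h1

/-- Any nonzero vector of `g (line w)` spans a ray sent to `[w]`. If there is none, `g (line w)` is
zero and evaluates to 0 everywhere, so `line w` evaluates to 0 on the image of `f`. -/
theorem exists_eq_or_forall_inner_eq_zero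
    (hfg : ∀ p S, rayEval p (g S) = rayEval (f p) S) {w : K} (hw : w ≠ 0) :
    (∃ p, f p = Projectivization.mk ℂ w hw) ∨
      ∀ p (v : K) (hv : v ≠ 0), f p = Projectivization.mk ℂ v hv → inner ℂ w v = 0 := by
  by_cases h : ∃ ψ ∈ g (line w), ψ ≠ 0
  · obtain ⟨ψ, hψg, hψ⟩ := h
    refine Or.inl ⟨Projectivization.mk ℂ ψ hψ, ?_⟩
    rw [← rayEval_line_eq_one_iff, ← hfg]
    exact (eval_eq_one_iff hψ _).2 hψg
  · refine Or.inr fun p v hv hp => ?_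
    push Not at h
    induction p using Projectivization.ind with | h ψ hψ
    have h1 := hfg (Projectivization.mk ℂ ψ hψ) (line w)
    rw [hp] at h1
    have h2 : (eval ψ (g (line w)) : ℝ) = eval v (line w) := congrArg Subtype.val h1
    have h3 : (g (line w)).toSubmodule.starProjection ψ = 0 :=
      h _ ((g (line w)).toSubmodule.starProjection_apply_mem ψ)
    rw [eval_line] at h2
    simp only [eval, h3, norm_zero] at h2
    have h4 : ‖w‖ ^ 2 * ‖v‖ ^ 2 ≠ 0 := by
      have := norm_ne_zero_iff.2 hw
      have := norm_ne_zero_iff.2 hv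
      positivity
    rw [eq_div_iff h4] at h2
    simpa using h2.symm

theorem surjective_of_adjoint [Nontrivial H] (hfg : ∀ p S, rayEval p (g S) = rayEval (f p) S) :
    Function.Surjective f := by
  intro q
  induction q using Projectivization.ind with | h w hw
  refine (exists_eq_or_forall_inner_eq_zero hfg hw).resolve_right fun hperp => ?_
  obtain ⟨φ, hφ⟩ := exists_ne (0 : H)
  obtain ⟨v, hv, hp⟩ : ∃ (v : K) (hv : v ≠ 0),
      f (Projectivization.mk ℂ φ hφ) = Projectivization.mk ℂ v hv :=
    ⟨_, Projectivization.rep_nonzero _, (Projectivization.mk_rep _).symm⟩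
  have hwv : inner ℂ w v = 0 := hperp _ v hv hp
  have hvw : inner ℂ v w = 0 := inner_eq_zero_symm.1 hwv
  have hvv : inner ℂ v v ≠ 0 := inner_self_ne_zero.2 hv
  have hww : inner ℂ w w ≠ 0 := inner_self_ne_zero.2 hw
  -- With `[v]` in the image and `w` orthogonal to it, `v + w` violates the dichotomy: it is
  -- orthogonal neither to `v` nor to `w`.
  have hne : v + w ≠ 0 := fun h => hvv <| by
    have := inner_add_right (𝕜 := ℂ) v v w
    rwa [h, inner_zero_right, hvw, add_zero, eq_comm] at this
  rcases exists_eq_or_forall_inner_eq_zero hfg hne with ⟨p, hp'⟩ | h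
  · have := hperp _ _ hne hp'
    rw [inner_add_right, hwv, zero_add] at this
    exact hww this
  · have := h _ v hv hp
    rw [inner_add_left, hwv, add_zero] at this
    exact hvv this

/-- The points of a Chu morphism are given by a semiunitary. -/
theorem exists_isSemiunitary [Nontrivial H] (hf : Function.Injective f)
    (hfg : ∀ p S, rayEval p (g S) = rayEval (f p) S) :
    ∃ (U : H → K) (hU : IsSemiunitary U), rayMap U hU = f := by
  -- Representatives are chosen with the norm of `x`, so that equality of transition probabilities
  -- becomes equality of moduli of inner products.
  have hrep : ∀ x : H, ∃ y : K, ‖y‖ = ‖x‖ ∧ ∀ hx : x ≠ 0, ∃ hy : y ≠ 0,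
      f (Projectivization.mk ℂ x hx) = Projectivization.mk ℂ y hy := by
    intro x
    by_cases hx : x = 0
    · exact ⟨0, by simp [hx], fun h => (h hx).elim⟩
    · set q := f (Projectivization.mk ℂ x hx) with hq
      have hr := norm_ne_zero_iff.2 q.rep_nonzero
      have hx' := norm_ne_zero_iff.2 hx
      have hc : ((‖x‖ / ‖q.rep‖ : ℝ) : ℂ) ≠ 0 := by
        exact_mod_cast div_ne_zero hx' hr
      refine ⟨((‖x‖ / ‖q.rep‖ : ℝ) : ℂ) • q.rep, ?_, fun _ =>
        ⟨smul_ne_zero hc q.rep_nonzero, ?_⟩⟩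
      · rw [norm_smul, Complex.norm_real, norm_div, norm_norm, norm_norm, div_mul_cancel₀ _ hr]
      · rw [← hq]
        conv_lhs => rw [← q.mk_rep]
        exact ((Projectivization.mk_eq_mk_iff' ℂ _ _ _ _).2 ⟨_, rfl⟩).symm
  choose T hnorm hT using hrep
  have hinner : ∀ x y, ‖inner ℂ (T x) (T y)‖ = ‖inner ℂ x y‖ := by
    intro x y
    by_cases hx : x = 0
    · have : T x = 0 := by rw [← norm_eq_zero, hnorm, hx, norm_zero]
      rw [this, hx, inner_zero_left, inner_zero_left]
    by_cases hy : y = 0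
    · have : T y = 0 := by rw [← norm_eq_zero, hnorm, hy, norm_zero]
      rw [this, hy, inner_zero_right, inner_zero_right]
    obtain ⟨hx', hfx⟩ := hT x hx
    obtain ⟨hy', hfy⟩ := hT y hy
    have h := congrArg Subtype.val (eval_line_eq hf hfg hx hy hx' hy' hfx hfy)
    rw [eval_line, eval_line, hnorm, hnorm] at h
    have h1 : ‖x‖ ^ 2 * ‖y‖ ^ 2 ≠ 0 := by
      have := norm_ne_zero_iff.2 hx
      have := norm_ne_zero_iff.2 hy
      positivity
    rw [div_left_inj' h1] at h
    exact ((sq_eq_sq₀ (norm_nonneg _) (norm_nonneg _)).1 h).symm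
  obtain ⟨e, he⟩ := exists_norm_eq (E := H) zero_le_one
  obtain ⟨U, hadd, ⟨σ, hσ, hsmul, hUinner⟩, hUT⟩ := exists_semilinear_of_norm_inner_eq hinner he
  have hUnorm : ∀ x, ‖U x‖ = ‖x‖ := by
    intro x
    obtain ⟨c, hc, h⟩ := hUT x
    rw [h, norm_smul, hc, one_mul, hnorm]
  have hUf : ∀ x (hx : x ≠ 0), ∃ hy : U x ≠ 0,
      f (Projectivization.mk ℂ x hx) = Projectivization.mk ℂ (U x) hy := by
    intro x hx
    obtain ⟨c, hc, h⟩ := hUT x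
    obtain ⟨hy, hfx⟩ := hT x hx
    refine ⟨by rw [← norm_ne_zero_iff, hUnorm]; exact norm_ne_zero_iff.2 hx, hfx.trans ?_⟩
    exact ((Projectivization.mk_eq_mk_iff' ℂ _ _ _ _).2 ⟨c, h.symm⟩).symm
  have hUsub : ∀ x y, U (x - y) = U x - U y := by
    intro x y
    rw [eq_sub_iff_add_eq, ← hadd, sub_add_cancel]
  have hσσ : ∀ c, σ (σ c) = c := by
    rcases hσ with rfl | rfl <;> simp
  have hbij : Function.Bijective U := by
    refine ⟨fun x y h => ?_, fun y => ?_⟩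
    · rw [← sub_eq_zero, ← norm_eq_zero, ← hUnorm, hUsub, h, sub_self, norm_zero]
    · by_cases hy : y = 0
      · exact ⟨0, by rw [hy, ← norm_eq_zero, hUnorm, norm_zero]⟩
      obtain ⟨p, hp⟩ := surjective_of_adjoint hfg (Projectivization.mk ℂ y hy)
      induction p using Projectivization.ind with | h x hx
      obtain ⟨hx', h⟩ := hUf x hx
      obtain ⟨t, ht⟩ := (Projectivization.mk_eq_mk_iff' ℂ _ _ _ _).1 (hp.symm.trans h)
      -- `σ` is an involution, so `σ t` is the scalar that `U` turns into `t`.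
      exact ⟨σ t • x, by rw [hsmul, hσσ, ht]⟩
  have hU : IsSemiunitary U := isSemiunitary_iff.2 ⟨σ, hσ, hbij, hadd, hsmul, hUinner⟩
  refine ⟨U, hU, funext fun p => ?_⟩
  induction p using Projectivization.ind with | h x hx
  exact (hUf x hx).2.symm

end RayMaps

/-! ### Uniqueness up to phase -/

theorem exists_ne_zero_orthogonal {H : Type*} [NormedAddCommGroup H] [InnerProductSpace ℂ H]
    (hH : 2 < Module.rank ℂ H) (φ ψ : H) :
    ∃ χ : H, χ ≠ 0 ∧ inner ℂ φ χ = 0 ∧ inner ℂ ψ χ = 0 := by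
  classical
  let S := Submodule.span ℂ (({φ, ψ} : Finset H) : Set H)
  have hS : S ≠ ⊤ := fun h => by
    have h1 : Module.rank ℂ S ≤ 2 := (rank_span_finset_le _).trans <| by
      exact_mod_cast Finset.card_le_two
    rw [h, rank_top] at h1
    exact hH.not_ge h1
  have hS' : Sᗮ ≠ ⊥ := fun h => hS (Submodule.orthogonal_eq_bot_iff.1 h)
  obtain ⟨χ, hχ, hne⟩ := (Submodule.ne_bot_iff _).1 hS'
  exact ⟨χ, hne, hχ φ (Submodule.subset_span (by simp)), hχ ψ (Submodule.subset_span (by simp))⟩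

/-- Semiunitaries that agree on rays agree up to phase. -/
theorem exists_phase_of_rayMap_eq {H K : Type*} [NormedAddCommGroup H] [InnerProductSpace ℂ H]
    [NormedAddCommGroup K] [InnerProductSpace ℂ K]
    (hH : 2 < Module.rank ℂ H) {U V : H → K} (hU : IsSemiunitary U) (hV : IsSemiunitary V)
    (h : rayMap U hU = rayMap V hV) : ∃ c : Circle, ∀ ψ, U ψ = (c : ℂ) • V ψ := by
  -- The condition `ψ ≠ 0` sits inside the existential so that `choose` gives a function on all of
  -- `H`; its value at 0 is irrelevant.
  have hc : ∀ ψ, ∃ c : ℂ, ψ ≠ 0 → U ψ = c • V ψ := by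
    intro ψ
    by_cases hψ : ψ = 0
    · exact ⟨0, fun h => (h hψ).elim⟩
    · obtain ⟨c, hc⟩ := (Projectivization.mk_eq_mk_iff' ℂ _ _ _ _).1
        (congrFun h (Projectivization.mk ℂ ψ hψ))
      exact ⟨c, fun _ => hc.symm⟩
  choose c hc using hc
  obtain ⟨σ, -, hVσ⟩ := isSemiunitary_iff.1 hV
  obtain ⟨τ, -, hUτ⟩ := isSemiunitary_iff.1 hU
  have hperp : ∀ φ ψ : H, φ ≠ 0 → ψ ≠ 0 → inner ℂ φ ψ = 0 → c φ = c (φ + ψ) := by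
    intro φ ψ hφ hψ hφψ
    have hφφ : inner ℂ φ φ ≠ 0 := inner_self_ne_zero.2 hφ
    have hne : φ + ψ ≠ 0 := fun h => hφφ <| by
      have := inner_add_right (𝕜 := ℂ) φ φ ψ
      rwa [h, inner_zero_right, hφψ, add_zero, eq_comm] at this
    -- Only additivity is used, so it does not matter whether `U` and `V` are of the same type.
    -- Pairing with `V φ` removes the `V ψ` terms.
    have h1 : c φ • V φ + c ψ • V ψ = c (φ + ψ) • (V φ + V ψ) := by
      rw [← hc _ hφ, ← hc _ hψ, ← hUτ.map_add, ← hVσ.map_add, ← hc _ hne]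
    have h2 := congrArg (inner ℂ (V φ)) h1
    simp only [inner_add_right, inner_smul_right, hVσ.inner_map φ ψ, hφψ, map_zero, mul_zero,
      add_zero] at h2
    exact mul_right_cancel₀ (inner_self_ne_zero.2 (hV.map_ne_zero hφ)) h2
  have hperp' : ∀ φ ψ : H, φ ≠ 0 → ψ ≠ 0 → inner ℂ φ ψ = 0 → c φ = c ψ := by
    intro φ ψ hφ hψ hφψ
    rw [hperp φ ψ hφ hψ hφψ, add_comm, ← hperp ψ φ hψ hφ (inner_eq_zero_symm.1 hφψ)]
  have hconst : ∀ φ ψ : H, φ ≠ 0 → ψ ≠ 0 → c φ = c ψ := by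
    intro φ ψ hφ hψ
    obtain ⟨χ, hχ, h1, h2⟩ := exists_ne_zero_orthogonal hH φ ψ
    rw [hperp' φ χ hφ hχ h1, hperp' ψ χ hψ hχ h2]
  obtain ⟨e, he, -⟩ := exists_ne_zero_orthogonal hH 0 0
  have hnorm : ‖c e‖ = 1 := by
    have h1 := congrArg norm (hc e he)
    rw [norm_smul, hU.norm_map, hV.norm_map] at h1
    exact (right_eq_mul₀ (norm_ne_zero_iff.2 he)).1 h1
  refine ⟨⟨c e, mem_sphere_zero_iff_norm.2 hnorm⟩, fun ψ => ?_⟩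
  by_cases hψ : ψ = 0
  · rw [hψ, hU.map_zero, hV.map_zero, smul_zero]
  · rw [hc ψ hψ, hconst ψ e hψ he]

/-! ### Full and faithful -/

/-- Adjointness prescribes the values of `f^*(a)` at every point in terms of `f_*`, and
extensionality recovers the attribute from these values. Fullness thus has to be checked on points
only. -/
theorem Chu.IsExtensional.hom_ext {L : Type} {C D : Chu.{u} L} (hC : C.IsExtensional)
    {f g : C ⟶ D} (h : f.pt = g.pt) : f = g :=
  Chu.Hom.ext h <| funext fun a => hC _ _ fun x => by
    rw [f.eval_eq, g.eval_eq, h]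

instance (H : SymmH.{u}) : Nontrivial H := by
  obtain ⟨e, he, -⟩ := exists_ne_zero_orthogonal H.two_lt_rank 0 0
  exact ⟨e, 0, he⟩

instance : PR.{u}.Full where
  map_surjective {X Y} f := by
    obtain ⟨U, hU, h⟩ := exists_isSemiunitary (H := X.as) (K := Y.as) (f := f.hom.hom.pt)
      (g := f.hom.hom.at') f.property f.hom.hom.eval_eq
    refine ⟨toPSymmH.map ⟨U, hU⟩, ?_⟩
    apply WideSubcategory.hom_ext
    apply InducedCategory.Hom.ext
    exact Chu.IsExtensional.hom_ext (rayChu_isBiextensional X.as).1 h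

instance : PR.{u}.Faithful where
  map_injective {X Y} f g h := by
    obtain ⟨X⟩ := X
    obtain ⟨Y⟩ := Y
    obtain ⟨U⟩ := f
    obtain ⟨V⟩ := g
    have h1 : rayMap U.toFun U.isSemiunitary = rayMap V.toFun V.isSemiunitary :=
      congrArg (fun k => k.hom.hom.pt) h
    exact CategoryTheory.Quotient.sound phaseRel
      (exists_phase_of_rayMap_eq X.two_lt_rank U.isSemiunitary V.isSemiunitary h1)

end QuantumChu

end

theorem theorem3 :
    (∀ H : QuantumChu.SymmH.{u},
      (QuantumChu.PR.obj (QuantumChu.toPSymmH.obj H)).obj.obj = QuantumChu.rayChu H) ∧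
    (∀ (H K : QuantumChu.SymmH.{u}) (U : H ⟶ K),
      (∀ (ψ : H) (hψ : ψ ≠ 0),
        (QuantumChu.PR.map (QuantumChu.toPSymmH.map U)).hom.hom.pt (Projectivization.mk ℂ ψ hψ) =
          Projectivization.mk ℂ (U.toFun ψ) (U.isSemiunitary.map_ne_zero hψ)) ∧
      (∀ S : ClosedSubmodule ℂ K,
        (QuantumChu.PR.map (QuantumChu.toPSymmH.map U)).hom.hom.at' S =
          QuantumChu.preimage U.toFun U.isSemiunitary S)) ∧
    QuantumChu.PR.{u}.Full ∧ QuantumChu.PR.{u}.Faithful := by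
  -- The formulas hold by definition; independence of the phase and functoriality are part of the
  -- construction of `PR`.
  exact ⟨fun _ => rfl, fun _ _ _ => ⟨fun _ _ => rfl, fun _ => rfl⟩, inferInstance, inferInstance⟩
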